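/- A topological space $X$ is scattered if every nonempty subset of $X$ has a relatively isolated point. A space is Corson compact if, for some set $\Gamma$, it is homeomorphic to a compact subset of $$\Sigma(\mathbb{R}^\Gamma)=\{x\in\mathbb{R}^\Gamma : \{\gamma\in\Gamma : x(\gamma)\neq 0\}\text{ is countable}\}$$ (with the topology inherited from the product $\mathbb{R}^\Gamma$), and Eberlein compact if it is homeomorphic to a weakly compact subset of a Banach space (with the weak topology). If $X$ is a Lindelöf scattered subspace of a Corson compact space, then $X$ is $\sigma$-compact. In particular, every Lindelöf scattered subspace of an Eberlein compact space is $\sigma$-compact. -/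

import Mathlib

/-- A topological space is scattered if every nonempty subset has a relatively isolated point. -/
def ScatteredSpace (X : Type*) [TopologicalSpace X] : Prop :=
  ∀ S : Set X, S.Nonempty → ∃ x ∈ S, ∃ U : Set X, IsOpen U ∧ U ∩ S = {x}

/-- The `Σ`-product of the family `Y` with base point `a`: all points of the full product that
differ from `a` in at most countably many coordinates. -/
def SigmaProduct {Γ : Type*} (Y : Γ → Type*) (a : ∀ γ, Y γ) : Set (∀ γ, Y γ) :=
  {y | {γ | y γ ≠ a γ}.Countable}

universe u v w

/-- A space is Corson compact if it is homeomorphic to a compact subset of `Σ(ℝ^Γ)`, the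
`Σ`-product of real lines with base point `0`, for some index set `Γ`. -/
def IsCorsonCompact (K : Type u) [TopologicalSpace K] : Prop :=
  ∃ (Γ : Type v) (C : Set (Γ → ℝ)),
    C ⊆ SigmaProduct (fun _ : Γ => ℝ) (fun _ => 0) ∧ IsCompact C ∧ Nonempty (K ≃ₜ C)

/-- A space is Eberlein compact if it is homeomorphic to a weakly compact subset of a
(real) Banach space. -/
def IsEberleinCompact (K : Type u) [TopologicalSpace K] : Prop :=
  ∃ (E : Type w) (_ : NormedAddCommGroup E) (_ : NormedSpace ℝ E) (_ : CompleteSpace E)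
    (C : Set (WeakSpace ℝ E)), IsCompact C ∧ Nonempty (K ≃ₜ C)

/-! Embed `X` in a compact `C ⊆ ℝ^Γ`. By scatteredness, every `y` has a closed box, cut out by
finitely many coordinates, in which all other points have smaller rank. The Lindelöf property
supplies a countable-valued operation on finite sets such that every `P` closed under it retracts
`X`: a point `y ∈ P` of least rank whose open box contains `x` must agree with `x` on all
coordinates attached to `P` (`exists_retractionSystem`).

Enlarging `P` either keeps the retract of `x` or lowers its rank, so along a well-ordered chain it
changes only finitely often (`finite_changes`). Induction on `#P` then gives a height on `P` whose
sublevel sets have closures inside `range e` (`exists_height_of_chain`, `exists_height`): if points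
of bounded height converge along an ultrafilter, their retracts at the last common change have the
same limit, and those retracts have bounded height at a smaller stage. Taking `P = univ` exhausts
`X` by countably many compact sets.

The Corson and Eberlein cases differ only in the coordinates attached to a finite set: supports in
the first, norming functionals for a countable set whose closure contains the span in the second. -/

open Set Filter Topology Cardinal

/-! ### Cantor–Bendixson rank. -/

section Rank

/-- The `o`-th open set of the Cantor–Bendixson filtration of `X`. -/
def cantorBendixsonOpen (X : Type u) [TopologicalSpace X] (o : Ordinal.{u}) : Set X :=
  {x | ∃ b, ∃ _ : b < o, ∃ U ∈ 𝓝 x, ∀ z ∈ U, z ≠ x → z ∈ cantorBendixsonOpen X b}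
termination_by o

theorem mem_cantorBendixsonOpen {X : Type u} [TopologicalSpace X] {o : Ordinal.{u}} {x : X} :
    x ∈ cantorBendixsonOpen X o ↔
      ∃ b < o, ∃ U ∈ 𝓝 x, ∀ z ∈ U, z ≠ x → z ∈ cantorBendixsonOpen X b := by
  rw [cantorBendixsonOpen]
  simp

theorem cantorBendixsonOpen_mono {X : Type u} [TopologicalSpace X] {o o' : Ordinal.{u}}
    (h : o ≤ o') : cantorBendixsonOpen X o ⊆ cantorBendixsonOpen X o' := by
  intro x hx
  rw [mem_cantorBendixsonOpen] at hx ⊢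
  obtain ⟨b, hb, H⟩ := hx
  exact ⟨b, hb.trans_le h, H⟩

theorem ScatteredSpace.exists_mem_cantorBendixsonOpen {X : Type u} [TopologicalSpace X]
    (hX : ScatteredSpace X) (x : X) : ∃ o, x ∈ cantorBendixsonOpen X o := by
  by_contra hx
  obtain ⟨y, hy, U, hU, hUy⟩ := hX {x | ¬ ∃ o, x ∈ cantorBendixsonOpen X o} ⟨x, hx⟩
  have hyU : y ∈ U := (hUy.symm ▸ mem_singleton y : y ∈ U ∩ _).1
  have key : ∀ z : X, ∃ o, z ∈ U → z ≠ y → z ∈ cantorBendixsonOpen X o := by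
    intro z
    by_cases hz : ∃ o, z ∈ cantorBendixsonOpen X o
    · exact hz.imp fun o ho _ _ => ho
    -- The value is arbitrary: `y` is the only unranked point of `U`.
    · refine ⟨0, fun hzU hzy => (hzy ?_).elim⟩
      have : z ∈ U ∩ {x | ¬ ∃ o, x ∈ cantorBendixsonOpen X o} := ⟨hzU, hz⟩
      rwa [hUy] at this
  choose o ho using key
  refine hy ⟨Order.succ (⨆ z, o z), mem_cantorBendixsonOpen.2
    ⟨_, Order.lt_succ _, U, hU.mem_nhds hyU, fun z hz hzy => ?_⟩⟩
  exact cantorBendixsonOpen_mono (Ordinal.le_iSup o z) (ho z hz hzy)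

/-- A scattered space has a rank function for which every point is locally the unique point of
maximal rank. -/
theorem ScatteredSpace.exists_rank {X : Type u} [TopologicalSpace X] (hX : ScatteredSpace X) :
    ∃ rk : X → Ordinal.{u}, ∀ x, ∃ U ∈ 𝓝 x, ∀ z ∈ U, z ≠ x → rk z < rk x := by
  have h := hX.exists_mem_cantorBendixsonOpen
  refine ⟨fun x => sInf {o | x ∈ cantorBendixsonOpen X o}, fun x => ?_⟩
  have hx : x ∈ cantorBendixsonOpen X (sInf {o | x ∈ cantorBendixsonOpen X o}) := csInf_mem (h x)
  obtain ⟨b, hb, U, hU, H⟩ := mem_cantorBendixsonOpen.1 hx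
  exact ⟨U, hU, fun z hz hzx =>
    (csInf_le' (s := {o | z ∈ cantorBendixsonOpen X o}) (H z hz hzx)).trans_lt hb⟩

end Rank

/-! ### Closure under finitary operations, and its cardinality. -/

section Closure

variable {T : Type u} (f : Finset T → Set T)

/-- `P` is closed under the set-valued finitary operation `f`. -/
def FinitaryClosed (P : Set T) : Prop := ∀ F : Finset T, ↑F ⊆ P → f F ⊆ P

/-- The least set that contains `B` and is closed under `f`. -/
def finitaryClosure (B : Set T) : Set T := ⋂₀ {P | FinitaryClosed f P ∧ B ⊆ P}

variable {f}

theorem subset_finitaryClosure (B : Set T) : B ⊆ finitaryClosure f B :=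
  subset_sInter fun _ h => h.2

theorem finitaryClosure_subset {B P : Set T} (hP : FinitaryClosed f P) (h : B ⊆ P) :
    finitaryClosure f B ⊆ P :=
  sInter_subset_of_mem ⟨hP, h⟩

theorem finitaryClosed_finitaryClosure (B : Set T) : FinitaryClosed f (finitaryClosure f B) :=
  fun F hF => subset_sInter fun _ hP =>
    hP.1 F (hF.trans (finitaryClosure_subset hP.1 hP.2))

theorem finitaryClosure_mono {B B' : Set T} (h : B ⊆ B') :
    finitaryClosure f B ⊆ finitaryClosure f B' :=
  finitaryClosure_subset (finitaryClosed_finitaryClosure _) (h.trans (subset_finitaryClosure _))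

theorem exists_finset_subset_finitaryClosure_of_forall {B : Set T} (F : Finset T)
    (hF : ∀ t ∈ F, ∃ G : Finset T, ↑G ⊆ B ∧ t ∈ finitaryClosure f ↑G) :
    ∃ G : Finset T, ↑G ⊆ B ∧ ↑F ⊆ finitaryClosure f (G : Set T) := by
  classical
  choose! G hG hG' using hF
  refine ⟨F.biUnion G, by simpa using hG, fun t ht => ?_⟩
  exact finitaryClosure_mono (by exact_mod_cast Finset.subset_biUnion_of_mem G ht) (hG' t ht)

theorem exists_finset_mem_finitaryClosure {B : Set T} {t : T} (ht : t ∈ finitaryClosure f B) :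
    ∃ G : Finset T, ↑G ⊆ B ∧ t ∈ finitaryClosure f ↑G := by
  refine finitaryClosure_subset (P := {t | ∃ G : Finset T, ↑G ⊆ B ∧ t ∈ finitaryClosure f ↑G})
    (fun F hF t ht => ?_) (fun t ht => ⟨{t}, by simpa using ht, ?_⟩) ht
  · obtain ⟨G, hG, hG'⟩ := exists_finset_subset_finitaryClosure_of_forall F hF
    exact ⟨G, hG, finitaryClosed_finitaryClosure _ F hG' ht⟩
  · exact subset_finitaryClosure _ (by simp)

theorem exists_finset_subset_finitaryClosure {B : Set T} (F : Finset T)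
    (hF : ↑F ⊆ finitaryClosure f B) :
    ∃ G : Finset T, ↑G ⊆ B ∧ ↑F ⊆ finitaryClosure f (G : Set T) :=
  exists_finset_subset_finitaryClosure_of_forall F
    fun _ ht => exists_finset_mem_finitaryClosure (hF ht)

theorem countable_finset_coe_subset {B : Set T} (hB : B.Countable) :
    {F : Finset T | ↑F ⊆ B}.Countable := by
  have := hB.to_subtype
  refine (countable_range fun F : Finset B => F.map (Function.Embedding.subtype _)).mono ?_
  intro F hF
  classical
  exact ⟨F.subtype (· ∈ B), Finset.subtype_map_of_mem hF⟩

theorem countable_finitaryClosure (hf : ∀ F, (f F).Countable) {B : Set T} (hB : B.Countable) :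
    (finitaryClosure f B).Countable := by
  -- Since `f` is finitary, `ω` iterations suffice: a finite subset of the increasing union lies in
  -- one stage.
  let step : Set T → Set T := fun C => C ∪ ⋃ F ∈ {F : Finset T | ↑F ⊆ C}, f F
  have hmono : Monotone fun n => step^[n] B := monotone_nat_of_le_succ fun n => by
    rw [Function.iterate_succ_apply']
    exact subset_union_left
  have hc : ∀ n, (step^[n] B).Countable := by
    intro n
    induction n with
    | zero => exact hB
    | succ n ih =>
      rw [Function.iterate_succ_apply']
      exact ih.union ((countable_finset_coe_subset ih).biUnion fun F _ => hf F)
  refine (countable_iUnion hc).mono (finitaryClosure_subset (fun F hF => ?_)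
    (subset_iUnion (fun n => step^[n] B) 0))
  obtain ⟨n, hn⟩ : ∃ n, ↑F ⊆ step^[n] B :=
    Directed.exists_mem_subset_of_finset_subset_biUnion hmono.directed_le hF
  refine Subset.trans ?_ (subset_iUnion _ (n + 1))
  rw [Function.iterate_succ_apply']
  exact Subset.trans (subset_biUnion_of_mem (u := f) hn) subset_union_right

/-- For uncountable `B`, the closure is covered by the countable closures of the finite subsets of
`B`, of which there are `#B`. -/
theorem mk_finitaryClosure_lt (hf : ∀ F, (f F).Countable) {B : Set T} {κ : Cardinal.{u}}
    (hκ : ℵ₀ < κ) (hB : #B < κ) : #(finitaryClosure f B) < κ := by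
  by_cases hBc : B.Countable
  · exact ((countable_finitaryClosure hf hBc).le_aleph0).trans_lt hκ
  · have hBi : ℵ₀ ≤ #B := (not_le.1 fun h => hBc ((le_aleph0_iff_set_countable).1 h)).le
    have : Infinite B := Cardinal.infinite_iff.2 hBi
    have hsub : finitaryClosure f B ⊆
        ⋃ G : Finset B, finitaryClosure f (G.map (Function.Embedding.subtype _) : Set T) := by
      intro t ht
      obtain ⟨G, hG, hG'⟩ := exists_finset_mem_finitaryClosure ht
      classical
      refine mem_iUnion.2 ⟨G.subtype (· ∈ B), ?_⟩
      rwa [Finset.subtype_map_of_mem hG]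
    refine ((mk_le_mk_of_subset hsub).trans (mk_iUnion_le_sum_mk.trans
      ((sum_le_sum _ (fun _ => ℵ₀) fun G =>
        (countable_finitaryClosure hf (Finset.countable_toSet _)).le_aleph0).trans ?_))).trans_lt hB
    rw [sum_const', mk_finset_of_infinite]
    exact (mul_eq_left hBi hBi aleph0_ne_zero).le

end Closure

/-! ### Retraction systems and the height induction. -/

section Retraction

/-- The coordinates attached to the finite subsets of `P`. -/
def attachedCoords {X Γ : Type*} (s : Finset X → Set Γ) (P : Set X) : Set Γ :=
  {γ | ∃ F : Finset X, ↑F ⊆ P ∧ γ ∈ s F}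

theorem attachedCoords_mono {X Γ : Type*} {s : Finset X → Set Γ} {P Q : Set X} (h : P ⊆ Q) :
    attachedCoords s P ⊆ attachedCoords s Q :=
  fun _ ⟨F, hF, hγ⟩ => ⟨F, hF.trans h, hγ⟩

/-- Any `n + 1` such indices would lie together in a single `D z` of size at most `n`. -/
theorem finite_setOf_eventually_mem {X ι : Type*} {l : Ultrafilter X} {D : X → Set ι} {n : ℕ}
    (hD : ∀ᶠ z in l, (D z).Finite ∧ (D z).ncard ≤ n) : {a | ∀ᶠ z in l, a ∈ D z}.Finite := by
  by_contra hinf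
  obtain ⟨t, ht, htn⟩ := Set.Infinite.exists_subset_card_eq hinf (n + 1)
  have : ∀ᶠ z in l, ∀ a ∈ t, a ∈ D z := (Filter.eventually_all_finset t).2 fun a ha => ht ha
  obtain ⟨z, hz, hfin, hn⟩ := (this.and hD).exists
  have := Set.ncard_le_ncard (s := (t : Set ι)) (fun a ha => hz a ha) hfin
  rw [Set.ncard_coe_finset] at this
  omega

/-- A system of rank-decreasing retractions of `X ⊆ ℝ^Γ` onto its subsets closed under a
finitary operation, where the retraction onto `P` keeps the coordinates attached to `P`. -/
structure RetractionSystem {X : Type u} {Γ : Type v} (e : X → Γ → ℝ) where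
  /-- the rank function -/
  rk : X → Ordinal.{u}
  /-- the coordinates attached to a finite set -/
  coords : Finset X → Set Γ
  /-- the finitary operation -/
  op : Finset X → Set X
  /-- the retraction onto a closed set -/
  retr : Set X → X → X
  countable_op : ∀ F, (op F).Countable
  separating : ∀ P : Set X, ∀ x ∈ closure (e '' P), ∀ y ∈ closure (e '' P),
    (∀ γ ∈ attachedCoords coords P, x γ = y γ) → x = y
  retr_mem : ∀ P, FinitaryClosed op P → ∀ x, retr P x ∈ P
  retr_apply : ∀ P, FinitaryClosed op P → ∀ x, ∀ γ ∈ attachedCoords coords P,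
    e (retr P x) γ = e x γ
  eq_or_rk_lt : ∀ y z, (∀ γ ∈ coords {y}, e z γ = e y γ) → z = y ∨ rk z < rk y

namespace RetractionSystem

variable {X : Type u} {Γ : Type v} {e : X → Γ → ℝ} (R : RetractionSystem e)

/-- Both retracts agree with `x` on the coordinates attached to `P`, which include those of the
point `retr P x` itself. -/
theorem retr_eq_or_rk_lt {P Q : Set X} (hP : FinitaryClosed R.op P) (hQ : FinitaryClosed R.op Q)
    (hPQ : P ⊆ Q) (x : X) : R.retr Q x = R.retr P x ∨ R.rk (R.retr Q x) < R.rk (R.retr P x) := by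
  refine R.eq_or_rk_lt _ _ fun γ hγ => ?_
  have hγP : γ ∈ attachedCoords R.coords P := ⟨_, by simpa using R.retr_mem P hP x, hγ⟩
  rw [R.retr_apply P hP x γ hγP, R.retr_apply Q hQ x γ (attachedCoords_mono hPQ hγP)]

theorem rk_retr_anti {P Q : Set X} (hP : FinitaryClosed R.op P) (hQ : FinitaryClosed R.op Q)
    (hPQ : P ⊆ Q) (x : X) : R.rk (R.retr Q x) ≤ R.rk (R.retr P x) := by
  rcases R.retr_eq_or_rk_lt hP hQ hPQ x with h | h
  · rw [h]
  · exact h.le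

variable {ι : Type*} [LinearOrder ι] (g : ι → X)

/-- The closed set generated by the `g i` with `i < a`. -/
def below (a : ι) : Set X := finitaryClosure R.op (g '' Iio a)

/-- The closed set generated by the `g i` with `i ≤ a`. -/
def upTo (a : ι) : Set X := finitaryClosure R.op (g '' Iic a)

/-- The stages at which the retract of `x` changes. -/
def changes (x : X) : Set ι := {a | R.retr (R.upTo g a) x ≠ R.retr (R.below g a) x}

theorem closed_below (a : ι) : FinitaryClosed R.op (R.below g a) :=
  finitaryClosed_finitaryClosure _

theorem closed_upTo (a : ι) : FinitaryClosed R.op (R.upTo g a) :=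
  finitaryClosed_finitaryClosure _

theorem below_subset_upTo (a : ι) : R.below g a ⊆ R.upTo g a :=
  finitaryClosure_mono (image_mono Iio_subset_Iic_self)

theorem upTo_subset_below {a b : ι} (h : a < b) : R.upTo g a ⊆ R.below g b :=
  finitaryClosure_mono (image_mono fun _ hc => lt_of_le_of_lt hc h)

theorem upTo_mono {a b : ι} (h : a ≤ b) : R.upTo g a ⊆ R.upTo g b :=
  finitaryClosure_mono (image_mono (Iic_subset_Iic.2 h))

/-- The rank drops strictly at each change and never rises in between, so the set of changes is
well-founded in both directions. -/
theorem finite_changes [WellFoundedLT ι] (x : X) : (R.changes g x).Finite := by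
  have hanti : ∀ a b : R.changes g x, a < b →
      R.rk (R.retr (R.upTo g b) x) < R.rk (R.retr (R.upTo g a) x) := fun a b hab =>
    (((R.retr_eq_or_rk_lt (R.closed_below g b) (R.closed_upTo g b)
      (R.below_subset_upTo g b.1) x).resolve_left b.2).trans_le
      (R.rk_retr_anti (R.closed_upTo g a) (R.closed_below g b) (R.upTo_subset_below g hab) x))
  have : WellFoundedGT (R.changes g x) :=
    ⟨Subrelation.wf (fun {a b} (hab : b < a) => hanti b a hab)
      (InvImage.wf (fun a : R.changes g x => R.rk (R.retr (R.upTo g a) x))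
        (wellFounded_lt (α := Ordinal)))⟩
  exact Finite.of_wellFoundedLT_wellFoundedGT (R.changes g x)

/-- A coordinate attached to the closed set generated by `g '' I` is already attached to a
finitely generated stage. -/
theorem mem_attachedCoords_finitaryClosure {I : Set ι} {γ : Γ}
    (h : γ ∈ attachedCoords R.coords (finitaryClosure R.op (g '' I))) :
    γ ∈ attachedCoords R.coords (finitaryClosure R.op ∅) ∨
      ∃ a ∈ I, γ ∈ attachedCoords R.coords (R.upTo g a) := by
  obtain ⟨F, hF, hγ⟩ := h
  obtain ⟨G, hG, hG'⟩ := exists_finset_subset_finitaryClosure F hF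
  classical
  obtain ⟨J, hJ, rfl⟩ := Finset.subset_set_image_iff.1 hG
  rcases J.eq_empty_or_nonempty with rfl | hne
  · exact Or.inl ⟨F, by simpa using hG', hγ⟩
  · refine Or.inr ⟨J.max' hne, hJ (J.max'_mem hne), F, hG'.trans (finitaryClosure_mono ?_), hγ⟩
    rw [Finset.coe_image]
    exact image_mono fun i hi => J.le_max' i hi

/-- If the retracts of `z` onto stages outside `Q` are eventually constant along an ultrafilter,
then `e z` and `e (retr Q z)` have the same limit. -/
theorem tendsto_retr_of_eventually_not_mem_changes [WellFoundedLT ι] {C : Set (Γ → ℝ)} (hC : IsCompact C)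
    (heC : ∀ x, e x ∈ C) {P Q : Set X} (hQ : FinitaryClosed R.op Q)
    (hgP : P = finitaryClosure R.op (range g)) (hQP : Q ⊆ P)
    {l : Ultrafilter X} (hlP : ∀ᶠ z in l, z ∈ P) {x : Γ → ℝ} (hx : Tendsto e l (𝓝 x))
    (H : ∀ b, R.upTo g b ⊆ Q ∨ Q ⊆ R.below g b ∧ ∀ᶠ z in l, b ∉ R.changes g z) :
    Tendsto (fun z => e (R.retr Q z)) l (𝓝 x) := by
  have hlim : ∀ P, ∃ y, Tendsto (fun z => e (R.retr P z)) l (𝓝 y) := by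
    intro P
    have hmem : ∀ᶠ z in (l.map fun z => e (R.retr P z) : Filter (Γ → ℝ)), z ∈ C :=
      Eventually.of_forall (f := (l : Filter X)) fun z => heC (R.retr P z)
    obtain ⟨y, -, hy⟩ := isCompact_iff_ultrafilter_le_nhds.1 hC
      (l.map fun z => e (R.retr P z)) (le_principal_iff.2 hmem)
    exact ⟨y, hy⟩
  have hcl : ∀ P, FinitaryClosed R.op P → ∀ y, Tendsto (fun z => e (R.retr P z)) l (𝓝 y) →
      y ∈ closure (e '' P) ∧ ∀ γ ∈ attachedCoords R.coords P, x γ = y γ := by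
    intro P hP y hy
    refine ⟨mem_closure_of_tendsto hy (Eventually.of_forall fun z =>
      mem_image_of_mem e (R.retr_mem P hP z)), fun γ hγ => ?_⟩
    refine tendsto_nhds_unique ((tendsto_pi_nhds.1 hx) γ) ?_
    simpa only [R.retr_apply P hP _ γ hγ] using (tendsto_pi_nhds.1 hy) γ
  obtain ⟨y, hy⟩ := hlim Q
  obtain ⟨hyQ, hxy⟩ := hcl Q hQ y hy
  have h0 : finitaryClosure R.op ∅ ⊆ Q := finitaryClosure_subset hQ (empty_subset _)
  have key : ∀ b, ∀ γ ∈ attachedCoords R.coords (R.upTo g b), x γ = y γ := by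
    intro b
    induction b using WellFoundedLT.induction with
    | ind b ih =>
      intro γ hγ
      rcases H b with hb | ⟨hQb, hb⟩
      · exact hxy γ (attachedCoords_mono hb hγ)
      · obtain ⟨w, hw⟩ := hlim (R.below g b)
        obtain ⟨hwb, hxw⟩ := hcl _ (R.closed_below g b) w hw
        -- Each coordinate attached to `below g b` is attached to the closure of `∅` or to an
        -- earlier stage, where the limits already agree; both limits lie in the closure of `e ''
        -- Q`.
        have hwy : w = y := by
          refine R.separating _ w hwb y (closure_mono (image_mono hQb) hyQ) fun δ hδ => ?_
          rw [← hxw δ hδ]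
          rcases R.mem_attachedCoords_finitaryClosure g hδ with h | ⟨c, hc, h⟩
          · exact hxy δ (attachedCoords_mono h0 h)
          · exact ih c hc δ h
        have hw' : Tendsto (fun z => e (R.retr (R.upTo g b) z)) l (𝓝 w) :=
          hw.congr' (hb.mono fun z hz => congrArg e (not_not.1 hz).symm)
        rw [← hwy]
        exact (hcl _ (R.closed_upTo g b) w hw').2 γ hγ
  have hxP : x ∈ closure (e '' P) :=
    mem_closure_of_tendsto hx (hlP.mono fun z hz => mem_image_of_mem e hz)
  have : x = y := by
    refine R.separating P x hxP y (closure_mono (image_mono hQP) hyQ) fun γ hγ => ?_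
    rw [hgP, ← image_univ] at hγ
    rcases R.mem_attachedCoords_finitaryClosure g hγ with h | ⟨c, -, h⟩
    · exact hxy γ (attachedCoords_mono h0 h)
    · exact key c γ h
  rwa [this]

/-- The inductive step along a well-ordered chain of closed sets. -/
theorem exists_height_of_chain [WellFoundedLT ι] {C : Set (Γ → ℝ)} (hC : IsCompact C)
    (heC : ∀ x, e x ∈ C) {P : Set X} (hgP : P = finitaryClosure R.op (range g))
    (h0 : ∃ N : X → ℕ, ∀ n, closure (e '' {x ∈ finitaryClosure R.op ∅ | N x ≤ n}) ⊆ range e)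
    (h : ∀ a, ∃ N : X → ℕ, ∀ n, closure (e '' {x ∈ R.upTo g a | N x ≤ n}) ⊆ range e) :
    ∃ N : X → ℕ, ∀ n, closure (e '' {x ∈ P | N x ≤ n}) ⊆ range e := by
  obtain ⟨N₀, hN₀⟩ := h0
  choose N hN using h
  -- The new height bounds the number of changes and the old heights of the retracts at the start
  -- and at every change.
  have hex : ∀ x, ∃ m : ℕ, N₀ (R.retr (finitaryClosure R.op ∅) x) ≤ m ∧
      (R.changes g x).ncard ≤ m ∧ ∀ a ∈ R.changes g x, N a (R.retr (R.upTo g a) x) ≤ m := by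
    intro x
    obtain ⟨k, hk⟩ := ((R.finite_changes g x).image
      fun a => N a (R.retr (R.upTo g a) x)).bddAbove
    refine ⟨max (N₀ (R.retr (finitaryClosure R.op ∅) x)) (max (R.changes g x).ncard k),
      le_max_left _ _, (le_max_left _ _).trans (le_max_right _ _), fun a ha => ?_⟩
    exact (hk (mem_image_of_mem _ ha)).trans ((le_max_right _ _).trans (le_max_right _ _))
  choose M hM₀ hMc hMN using hex
  refine ⟨M, fun n x hx => ?_⟩
  rw [mem_closure_iff_nhds_ne_bot, ← map_principal] at hx
  have hne : (comap e (𝓝 x) ⊓ 𝓟 {x ∈ P | M x ≤ n}).NeBot := by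
    rw [inf_comm, ← map_neBot_iff e, Filter.push_pull, inf_comm]
    exact ⟨hx⟩
  let l := Ultrafilter.of (comap e (𝓝 x) ⊓ 𝓟 {x ∈ P | M x ≤ n})
  have hl : (l : Filter X) ≤ comap e (𝓝 x) ⊓ 𝓟 {x ∈ P | M x ≤ n} := Ultrafilter.of_le _
  have hlx : Tendsto e l (𝓝 x) := tendsto_iff_comap.2 (hl.trans inf_le_left)
  have hlZ : ∀ᶠ z in l, z ∈ P ∧ M z ≤ n := le_principal_iff.1 (hl.trans inf_le_right)
  have hlP : ∀ᶠ z in l, z ∈ P := hlZ.mono fun _ h => h.1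
  have hD : {a | ∀ᶠ z in l, a ∈ R.changes g z}.Finite := finite_setOf_eventually_mem
    (hlZ.mono fun z hz => ⟨R.finite_changes g z, (hMc z).trans hz.2⟩)
  rcases eq_empty_or_nonempty {a | ∀ᶠ z in l, a ∈ R.changes g z} with hDe | hDne
  · have hcl := finitaryClosed_finitaryClosure (f := R.op) ∅
    have hlim := R.tendsto_retr_of_eventually_not_mem_changes g hC heC hcl hgP
      (hgP ▸ finitaryClosure_mono (empty_subset _)) hlP hlx
      fun b => Or.inr ⟨finitaryClosure_mono (empty_subset _),
        Ultrafilter.eventually_not.2 fun hb => (hDe ▸ hb : b ∈ (∅ : Set ι))⟩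
    exact hN₀ n (mem_closure_of_tendsto hlim (hlZ.mono fun z hz =>
      mem_image_of_mem e ⟨R.retr_mem _ hcl z, (hM₀ z).trans hz.2⟩))
  -- Past the last common change `a`, each single stage is eventually not a change, so the retracts
  -- onto `upTo g a` converge to `x`.
  · obtain ⟨a, ha, hmax⟩ := hD.exists_maximal hDne
    have hlim := R.tendsto_retr_of_eventually_not_mem_changes g hC heC (R.closed_upTo g a) hgP
      (hgP ▸ finitaryClosure_mono (image_subset_range _ _)) hlP hlx fun b => by
        rcases le_or_gt b a with hba | hab
        · exact Or.inl (R.upTo_mono g hba)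
        · refine Or.inr ⟨R.upTo_subset_below g hab, Ultrafilter.eventually_not.2 fun hb => ?_⟩
          exact (hmax hb hab.le).not_gt hab
    refine hN a n (mem_closure_of_tendsto hlim ((hlZ.and ha).mono fun z hz =>
      mem_image_of_mem e ⟨R.retr_mem _ (R.closed_upTo g a) z, (hMN z a hz.2).trans hz.1.2⟩))

/-- A height injective on `P` has finite, hence closed, sublevel sets. -/
theorem exists_height_of_countable {P : Set X} (hP : P.Countable) :
    ∃ N : X → ℕ, ∀ n, closure (e '' {x ∈ P | N x ≤ n}) ⊆ range e := by
  obtain ⟨N, hN⟩ := Set.countable_iff_exists_injOn.1 hP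
  refine ⟨N, fun n => ?_⟩
  have hfin : {x ∈ P | N x ≤ n}.Finite :=
    Set.Finite.of_finite_image ((finite_Iic n).subset (by rintro _ ⟨x, hx, rfl⟩; exact hx.2))
      (hN.mono fun x hx => hx.1)
  rw [(hfin.image e).isClosed.closure_eq]
  exact image_subset_range _ _

theorem exists_height {C : Set (Γ → ℝ)} (hC : IsCompact C) (heC : ∀ x, e x ∈ C) {P : Set X}
    (hP : FinitaryClosed R.op P) :
    ∃ N : X → ℕ, ∀ n, closure (e '' {x ∈ P | N x ≤ n}) ⊆ range e := by
  induction hκ : #P using WellFoundedLT.induction generalizing P with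
  | ind κ ih =>
    by_cases hc : P.Countable
    · exact exists_height_of_countable hc
    have hκ' : ℵ₀ < κ := by
      rw [← hκ]
      exact not_le.1 fun h => hc (le_aleph0_iff_set_countable.1 h)
    -- In the order type of `κ.ord`, every initial segment has fewer than `κ` elements.
    obtain ⟨φ⟩ : Nonempty (κ.ord.ToType ≃ P) := Cardinal.eq.1 (by rw [mk_ord_toType, hκ])
    let g : κ.ord.ToType → X := fun i => φ i
    have hrange : range g = P := by
      have : g = Subtype.val ∘ φ := rfl
      rw [this, range_comp, φ.range_eq_univ, image_univ, Subtype.range_coe]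
    refine R.exists_height_of_chain g hC heC (P := P) ?_ ?_ fun a => ?_
    · rw [hrange]
      exact (subset_finitaryClosure P).antisymm (finitaryClosure_subset hP Subset.rfl)
    · exact exists_height_of_countable (countable_finitaryClosure R.countable_op countable_empty)
    · refine ih _ ?_ (R.closed_upTo g a) rfl
      refine mk_finitaryClosure_lt R.countable_op hκ' (mk_image_le.trans_lt ?_)
      have hIio : #(Iio a) < κ := by simpa using mk_Iio_lt a (by simp)
      rw [← Iio_insert]
      exact (mk_insert_le).trans_lt (add_lt_of_lt hκ'.le hIio
        (one_lt_aleph0.trans hκ'))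

theorem isSigmaCompact_range (R : RetractionSystem e) {C : Set (Γ → ℝ)} (hC : IsCompact C) (heC : ∀ x, e x ∈ C) :
    IsSigmaCompact (range e) := by
  obtain ⟨N, hN⟩ := R.exists_height hC heC (P := Set.univ) fun _ _ => subset_univ _
  refine ⟨fun n => closure (e '' {x ∈ Set.univ | N x ≤ n}), fun n => ?_, ?_⟩
  · exact hC.of_isClosed_subset isClosed_closure
      (closure_minimal (image_subset_iff.2 fun x _ => heC x) hC.isClosed)
  · refine (iUnion_subset hN).antisymm ?_
    rintro _ ⟨x, rfl⟩
    exact mem_iUnion.2 ⟨N x, subset_closure ⟨x, ⟨trivial, le_rfl⟩, rfl⟩⟩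

end RetractionSystem

end Retraction

/-! ### Building retractions from scatteredness and the Lindelöf property. -/

section Construction

theorem exists_finset_forall_abs_sub_le_subset {Γ : Type*} {y : Γ → ℝ} {U : Set (Γ → ℝ)}
    (hU : U ∈ 𝓝 y) :
    ∃ F : Finset Γ, ∃ ε : ℝ, 0 < ε ∧ ∀ z, (∀ γ ∈ F, |z γ - y γ| ≤ ε) → z ∈ U := by
  rw [nhds_pi, Filter.mem_pi'] at hU
  obtain ⟨F, t, ht, htU⟩ := hU
  have : ∀ γ, ∃ ε : ℝ, 0 < ε ∧ Metric.closedBall (y γ) ε ⊆ t γ := fun γ =>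
    Metric.nhds_basis_closedBall.mem_iff.1 (ht γ)
  choose ε hε hεt using this
  rcases F.eq_empty_or_nonempty with rfl | hne
  · exact ⟨∅, 1, one_pos, fun z _ => htU (by simp)⟩
  · refine ⟨F, F.inf' hne ε, (Finset.lt_inf'_iff hne).2 fun γ _ => hε γ, fun z hz => htU ?_⟩
    intro γ hγ
    exact hεt γ ((hz γ hγ).trans (Finset.inf'_le ε hγ))

theorem isOpen_forall_abs_sub_lt {X Γ : Type*} [TopologicalSpace X] {e : X → Γ → ℝ}
    (he : Continuous e) (F : Finset Γ) (y : X) (ε : ℝ) :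
    IsOpen {z | ∀ γ ∈ F, |e z γ - e y γ| < ε} := by
  simp only [ofPred_forall]
  exact isOpen_biInter_finset fun γ _ => isOpen_lt (by fun_prop) continuous_const

theorem isClosed_forall_abs_sub_le {X Γ : Type*} [TopologicalSpace X] {e : X → Γ → ℝ}
    (he : Continuous e) (F : Finset Γ) (y : X) (ε : ℝ) :
    IsClosed {z | ∀ γ ∈ F, |e z γ - e y γ| ≤ ε} := by
  simp only [ofPred_forall]
  exact isClosed_biInter fun γ _ => isClosed_le (by fun_prop) continuous_const

theorem exists_retractionSystem {X : Type u} [TopologicalSpace X] [LindelofSpace X]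
    (hX : ScatteredSpace X) {Γ : Type v} {e : X → Γ → ℝ} (he : IsInducing e)
    (s : Finset X → Set Γ) (hs : ∀ F, (s F).Countable)
    (hsep : ∀ P : Set X, ∀ x ∈ closure (e '' P), ∀ y ∈ closure (e '' P),
      (∀ γ ∈ attachedCoords s P, x γ = y γ) → x = y) :
    Nonempty (RetractionSystem e) := by
  classical
  obtain ⟨rk, hrk⟩ := hX.exists_rank
  have hbox : ∀ y, ∃ F : Finset Γ, ∃ ε : ℝ, 0 < ε ∧
      ∀ z, (∀ γ ∈ F, |e z γ - e y γ| ≤ ε) → z = y ∨ rk z < rk y := by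
    intro y
    obtain ⟨U, hU, H⟩ := hrk y
    rw [he.nhds_eq_comap, mem_comap] at hU
    obtain ⟨V, hV, hVU⟩ := hU
    obtain ⟨F, ε, hε, hF⟩ := exists_finset_forall_abs_sub_le_subset hV
    exact ⟨F, ε, hε, fun z hz => or_iff_not_imp_left.2 (H z (hVU (hF (e z) hz)))⟩
  choose F ε hε hF using hbox
  have hnhds : ∀ y, {z | ∀ γ ∈ F y, |e z γ - e y γ| < ε y} ∈ 𝓝 y := fun y =>
    (isOpen_forall_abs_sub_lt he.continuous _ _ _).mem_nhds fun γ _ => by simpa using hε y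
  -- The points of the box of `y` that differ from `y` at `γ` by a definite amount. This set is
  -- closed, so countably many boxes centred in it cover it; their centres have smaller rank than
  -- `y`.
  let D : X → Γ → ℕ → Set X := fun y γ q =>
    {z | ∀ δ ∈ F y, |e z δ - e y δ| ≤ ε y} ∩ {z | 1 / ((q : ℝ) + 1) ≤ |e z γ - e y γ|}
  have hD : ∀ y γ q, IsLindelof (D y γ q) := fun y γ q =>
    ((isClosed_forall_abs_sub_le he.continuous _ _ _).inter
      (isClosed_le continuous_const (by have := he.continuous; fun_prop))).isLindelof
  choose t htc htD htcov using fun y γ q => (hD y γ q).elim_nhds_subcover _ fun x _ => hnhds x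
  obtain ⟨t₀, ht₀c, -, ht₀cov⟩ := (isLindelof_univ (X := X)).elim_nhds_subcover _
    fun x _ => hnhds x
  let s' : Finset X → Set Γ := fun G => s G ∪ ⋃ y ∈ G, (F y : Set Γ)
  have hs' : ∀ G, (s' G).Countable := fun G =>
    (hs G).union (G.countable_toSet.biUnion fun y _ => (F y).countable_toSet)
  -- The centres `t₀` put every point in the box of some member of a closed set. Ranging over `G' ⊆
  -- G` allows `y` to be adjoined without assuming `s` monotone.
  let op : Finset X → Set X := fun G =>
    t₀ ∪ ⋃ y ∈ G, ⋃ G' ∈ G.powerset, ⋃ γ ∈ s' G', ⋃ q, t y γ q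
  have hop : ∀ G, (op G).Countable := fun G =>
    ht₀c.union (G.countable_toSet.biUnion fun y _ => G.powerset.countable_toSet.biUnion
      fun G' _ => (hs' G').biUnion fun γ _ => countable_iUnion fun q => htc y γ q)
  have hretr : ∀ P, FinitaryClosed op P → ∀ x, ∃ y ∈ P,
      ∀ γ ∈ attachedCoords s' P, e y γ = e x γ := by
    intro P hP x
    have hne : {y ∈ P | ∀ γ ∈ F y, |e x γ - e y γ| < ε y}.Nonempty := by
      obtain ⟨y, hy, hxy⟩ := mem_iUnion₂.1 (ht₀cov (Set.mem_univ x))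
      exact ⟨y, hP ∅ (by simp) (Or.inl hy), hxy⟩
    obtain ⟨y, ⟨hyP, hxy⟩, hmin⟩ :=
      (InvImage.wf rk (wellFounded_lt (α := Ordinal))).has_min _ hne
    refine ⟨y, hyP, ?_⟩
    -- A disagreement at an attached `γ` puts `x` in some `D y γ q`, hence in the box of a centre in
    -- `P` of smaller rank.
    by_contra! hγ
    obtain ⟨γ, ⟨G, hG, hγG⟩, hne⟩ := hγ
    obtain ⟨q, hq⟩ := exists_nat_one_div_lt (abs_pos.2 (sub_ne_zero.2 hne.symm))
    have hxD : x ∈ D y γ q := ⟨fun δ hδ => (hxy δ hδ).le, hq.le⟩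
    obtain ⟨c, hc, hxc⟩ := mem_iUnion₂.1 (htcov y γ q hxD)
    have hcP : c ∈ P := by
      refine hP (insert y G) (by simpa [insert_subset_iff] using ⟨hyP, hG⟩) (Or.inr ?_)
      simp only [mem_iUnion]
      exact ⟨y, Finset.mem_insert_self _ _, G, Finset.mem_powerset.2 (Finset.subset_insert _ _),
        γ, hγG, q, hc⟩
    have hcD := htD y γ q c hc
    refine hmin c ⟨hcP, hxc⟩ ((hF y c hcD.1).resolve_left ?_)
    rintro rfl
    have h1 : 1 / ((q : ℝ) + 1) ≤ |e c γ - e c γ| := hcD.2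
    rw [sub_self, abs_zero] at h1
    exact absurd h1 (not_le.2 (by positivity))
  have hretr' : ∀ P x, ∃ y, FinitaryClosed op P → y ∈ P ∧
      ∀ γ ∈ attachedCoords s' P, e y γ = e x γ := by
    intro P x
    by_cases hP : FinitaryClosed op P
    · obtain ⟨y, hy⟩ := hretr P hP x
      exact ⟨y, fun _ => hy⟩
    · exact ⟨x, fun h => (hP h).elim⟩
  choose r hr using hretr'
  exact ⟨{
    rk := rk
    coords := s'
    op := op
    retr := r
    countable_op := hop
    separating := fun P x hx y hy h => hsep P x hx y hy
      fun γ ⟨G, hG, hγ⟩ => h γ ⟨G, hG, Or.inl hγ⟩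
    retr_mem := fun P hP x => (hr P x hP).1
    retr_apply := fun P hP x => (hr P x hP).2
    eq_or_rk_lt := fun y z h => hF y z fun γ hγ => by
      rw [h γ (Or.inr (by simpa using hγ)), sub_self, abs_zero]
      exact (hε y).le }⟩

/-- A Lindelöf scattered space embedded in a compact subset of `ℝ^Γ` is `σ`-compact, provided
that the closure of every subset is separated by countable sets of coordinates attached to its
finite subsets. -/
theorem ScatteredSpace.sigmaCompactSpace {X : Type u} [TopologicalSpace X] [LindelofSpace X]
    (hX : ScatteredSpace X) {Γ : Type v} {e : X → Γ → ℝ} (he : IsEmbedding e)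
    {C : Set (Γ → ℝ)} (hC : IsCompact C) (heC : ∀ x, e x ∈ C)
    (s : Finset X → Set Γ) (hs : ∀ F, (s F).Countable)
    (hsep : ∀ P : Set X, ∀ x ∈ closure (e '' P), ∀ y ∈ closure (e '' P),
      (∀ γ ∈ attachedCoords s P, x γ = y γ) → x = y) :
    SigmaCompactSpace X := by
  obtain ⟨R⟩ := exists_retractionSystem hX he.isInducing s hs hsep
  rw [← isSigmaCompact_univ_iff, he.isSigmaCompact_iff, image_univ]
  exact R.isSigmaCompact_range hC heC

end Construction

/-! ### Corson compacta. -/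

section Corson

theorem IsCorsonCompact.sigmaCompactSpace {K : Type u} [TopologicalSpace K]
    (hK : IsCorsonCompact.{u, v} K) {X : Set K} [LindelofSpace X] (hX : ScatteredSpace X) :
    SigmaCompactSpace X := by
  obtain ⟨Γ, C, hCS, hC, ⟨h⟩⟩ := hK
  let e : X → Γ → ℝ := fun x => h x
  have he : IsEmbedding e :=
    IsEmbedding.subtypeVal.comp (h.isEmbedding.comp IsEmbedding.subtypeVal)
  have heC : ∀ x, e x ∈ C := fun x => (h x).2
  refine hX.sigmaCompactSpace he hC heC (fun F => ⋃ x ∈ F, {γ | e x γ ≠ 0})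
    (fun F => F.countable_toSet.biUnion fun x _ => hCS (heC x)) fun P x hx y hy hxy => ?_
  -- Coordinates outside all supports of points of `P` vanish on the closure, so the supports
  -- separate it.
  have hzero : ∀ γ, (∀ z ∈ P, e z γ = 0) → ∀ w ∈ closure (e '' P), w γ = 0 := by
    intro γ hγ
    refine closure_minimal (t := {w : Γ → ℝ | w γ = 0}) ?_
      (isClosed_eq (continuous_apply γ) continuous_const)
    rintro _ ⟨z, hz, rfl⟩
    exact hγ z hz
  funext γ
  by_cases hγ : ∀ z ∈ P, e z γ = 0
  · rw [hzero γ hγ x hx, hzero γ hγ y hy]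
  · push Not at hγ
    obtain ⟨z, hz, hne⟩ := hγ
    exact hxy γ ⟨{z}, by simpa using hz, by simpa using hne⟩

end Corson

/-! ### Eberlein compacta. -/

section Eberlein

/-- Functionals norming a set `c` separate the points of every vector subspace contained in its
closure. -/
theorem eq_zero_of_forall_norming_eq_zero {E : Type*} [NormedAddCommGroup E] [NormedSpace ℝ E]
    {φ : E → StrongDual ℝ E} (hφ : ∀ u, ‖φ u‖ ≤ 1 ∧ φ u u = ‖u‖) {c : Set E} {v : E}
    (hv : v ∈ closure c) (h : ∀ u ∈ c, φ u v = 0) : v = 0 := by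
  by_contra hne
  have hpos : 0 < ‖v‖ := norm_pos_iff.2 hne
  obtain ⟨u, hu, huv⟩ := Metric.mem_closure_iff.1 hv (‖v‖ / 2) (half_pos hpos)
  have h1 : ‖u‖ = φ u (u - v) := by rw [map_sub, h u hu, (hφ u).2, sub_zero]
  have h2 : φ u (u - v) ≤ ‖u - v‖ :=
    (le_abs_self _).trans (((φ u).le_opNorm _).trans (mul_le_of_le_one_left (norm_nonneg _) (hφ u).1))
  have h3 : ‖v‖ ≤ ‖u‖ + ‖u - v‖ := by
    rw [norm_sub_rev]
    exact norm_le_norm_add_norm_sub' v u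
  rw [dist_eq_norm, norm_sub_rev] at huv
  linarith

theorem IsEberleinCompact.sigmaCompactSpace {K : Type u} [TopologicalSpace K]
    (hK : IsEberleinCompact.{u, w} K) {X : Set K} [LindelofSpace X] (hX : ScatteredSpace X) :
    SigmaCompactSpace X := by
  obtain ⟨E, _, _, _, C, hC, ⟨h⟩⟩ := hK
  let ev : WeakSpace ℝ E → StrongDual ℝ E → ℝ := fun x f => f ((toWeakSpace ℝ E).symm x)
  have hev : IsEmbedding ev := by
    refine WeakBilin.isEmbedding (B := (topDualPairing ℝ E).flip) fun x y hxy => ?_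
    obtain ⟨f, -, hf⟩ := exists_dual_vector'' ℝ ((x : E) - y)
    have hfxy : f x = f y := LinearMap.congr_fun hxy f
    rw [map_sub, hfxy, sub_self] at hf
    exact sub_eq_zero.1 (norm_eq_zero.1 hf.symm)
  let a : X → WeakSpace ℝ E := fun x => h x
  have ha : IsEmbedding a :=
    IsEmbedding.subtypeVal.comp (h.isEmbedding.comp IsEmbedding.subtypeVal)
  have haC : ∀ x, a x ∈ C := fun x => (h x).2
  choose φ hφ using fun u : E => exists_dual_vector'' ℝ u
  have hsepar : ∀ F : Finset X, ∃ c : Set E, c.Countable ∧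
      (Submodule.span ℝ ((fun x => (toWeakSpace ℝ E).symm (a x)) '' (F : Set X)) : Set E) ⊆
        closure c := fun F =>
    ((F.countable_toSet.image _).isSeparable.span (R := ℝ))
  choose c hcc hc using hsepar
  refine hX.sigmaCompactSpace (hev.comp ha) (hC.image hev.continuous)
    (fun x => mem_image_of_mem ev (haC x)) (fun F => φ '' c F) (fun F => (hcc F).image φ) ?_
  intro P x hx y hy hxy
  let b : X → E := fun x => (toWeakSpace ℝ E).symm (a x)
  let V : Submodule ℝ E := Submodule.span ℝ (b '' P)
  have hcl : ∀ z ∈ closure ((ev ∘ a) '' P), ∃ v ∈ closure (V : Set E),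
      ev (toWeakSpace ℝ E v) = z := by
    intro z hz
    have hzC : z ∈ ev '' C := closure_minimal (by
      rintro _ ⟨p, -, rfl⟩
      exact mem_image_of_mem ev (haC p)) (hC.image hev.continuous).isClosed hz
    obtain ⟨w, -, rfl⟩ := hzC
    refine ⟨(toWeakSpace ℝ E).symm w, ?_, by simp⟩
    rw [image_comp] at hz
    have hw : w ∈ closure (a '' P) := by
      rw [hev.closure_eq_preimage_closure_image]
      exact hz
    have hsub : a '' P ⊆ toWeakSpace ℝ E '' (V : Set E) := by
      rintro _ ⟨p, hp, rfl⟩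
      exact ⟨b p, Submodule.subset_span (mem_image_of_mem b hp), by simp [b]⟩
    have hw' := closure_mono hsub hw
    -- Mazur: weak and norm closures of the convex set `V` coincide, so weak limits can be tested by
    -- norm approximation.
    rw [← V.convex.toWeakSpace_closure ℝ] at hw'
    obtain ⟨v, hv, rfl⟩ := hw'
    simpa using hv
  obtain ⟨v, hv, rfl⟩ := hcl x hx
  obtain ⟨v', hv', rfl⟩ := hcl y hy
  have hsub : v - v' ∈ closure (V : Set E) :=
    (V.topologicalClosure).sub_mem hv hv'
  -- Every vector of `V` is in the span of finitely many points of `P`, so the sets `c F`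
  -- approximate all of `V`.
  have hVc : (V : Set E) ⊆ closure (⋃ F ∈ {F : Finset X | ↑F ⊆ P}, c F) := by
    intro u hu
    obtain ⟨T, hT, hu⟩ := Submodule.mem_span_finite_of_mem_span hu
    classical
    obtain ⟨F, hF, rfl⟩ := Finset.subset_set_image_iff.1 hT
    rw [Finset.coe_image] at hu
    exact closure_mono (subset_biUnion_of_mem (u := c) hF) (hc F hu)
  have hzero := eq_zero_of_forall_norming_eq_zero hφ
    (closure_minimal hVc isClosed_closure hsub) fun u hu => by
      obtain ⟨F, hF, huF⟩ := mem_iUnion₂.1 hu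
      have := hxy (φ u) ⟨F, hF, mem_image_of_mem φ huF⟩
      rw [map_sub, sub_eq_zero]
      simpa [ev] using this
  rw [sub_eq_zero.1 hzero]

end Eberlein

theorem corollary2 :
    (∀ (K : Type u) [TopologicalSpace K], IsCorsonCompact.{u, v} K →
      ∀ X : Set K, LindelofSpace X → ScatteredSpace X → SigmaCompactSpace X) ∧
    (∀ (K : Type u) [TopologicalSpace K], IsEberleinCompact.{u, w} K →
      ∀ X : Set K, LindelofSpace X → ScatteredSpace X → SigmaCompactSpace X) := by
  exact ⟨fun _ _ hK _ _ hX => hK.sigmaCompactSpace hX,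
    fun _ _ hK _ _ hX => hK.sigmaCompactSpace hX⟩
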